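/- Let $A$ and $B$ be finite-dimensional quantum systems with $d_A=\dim A\ge 1$. A channel is a completely positive trace-preserving linear map, and an instrument from $A$ to $B$ is a finite family $\mathcal E=\{\mathcal E_a\}_a$ of completely positive trace-non-increasing linear maps from operators on $A$ to operators on $B$ such that $\sum_a\mathcal E_a$ is a channel. An instrument $\mathcal L=\{\mathcal L_a\}_a$ is non-interactive ($\mathcal L\in\mathbf{NI}$) if $\mathcal L_a(\cdot)=\sum_\lambda q_\lambda\, p(a|\lambda)\,\sigma_\lambda\operatorname{tr}(\cdot)$ for all $a$, where $\lambda$ has finitely many values, $q$ and $p(\cdot|\lambda)$ are probability distributions and $\sigma_\lambda$ are states of $B$. The interactive instrument robustness of $\mathcal E$ is $$R(\mathcal E)=\min\Big\{t\ge 0 \;\Big|\; \Big\{\tfrac{\mathcal E_a+t\,\mathcal N_a}{1+t}\Big\}_a\in\mathbf{NI}\ \text{ for some instrument } \mathcal N \text{ from } A \text{ to } B \text{ with the same outcomes}\Big\}.$$ The optimal average fidelity and the optimal maximally entangled fraction are $$F_{\rm ave}(\mathcal E)=\max_{\{\Lambda_a\}_a}\int d\psi\;\langle\psi|\sum_a(\Lambda_a\circ\mathcal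 E_a)(|\psi\rangle\langle\psi|)|\psi\rangle,$$ $$F_+(\mathcal E)=\max_{\{\Lambda_a\}_a}\sum_a\langle\Phi_+|\big[\mathrm{id}\otimes(\Lambda_a\circ\mathcal E_a)\big](|\Phi_+\rangle\langle\Phi_+|)|\Phi_+\rangle,$$ where both maxima run over families of channels $\Lambda_a$ from $B$ to $A$ (one for each outcome $a$), $d\psi$ is the Haar (unitarily invariant) probability measure on the unit vectors of $A$, and $|\Phi_+\rangle=d_A^{-1/2}\sum_i|i\rangle\otimes|i\rangle$. Then for every instrument $\mathcal E$ from $A$ to $B$ the minimum and both maxima are attained, and $$F_{\rm ave}(\mathcal E)=\frac1{d_A}\Big(1+\frac{R(\mathcal E)}{d_A+1}\Big)\qquad\text{and}\qquad F_{\rm ave}(\mathcal E)=\frac{1+d_A\,F_+(\mathcal E)}{d_A+1}.$$ -/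

import Mathlib

open MeasureTheory Matrix
open scoped ComplexOrder

namespace QInstrument

noncomputable section

/-- The map `id_R ⊗ E` on operators of `ℂ^R ⊗ ℂ^A`: it applies `E` to each `R`-block. -/
def idTensor {A B : Type*} (R : Type*) (E : Matrix A A ℂ →ₗ[ℂ] Matrix B B ℂ)
    (M : Matrix (R × A) (R × A) ℂ) : Matrix (R × B) (R × B) ℂ :=
  Matrix.of fun x y => E (Matrix.of fun a a' => M (x.1, a) (y.1, a')) x.2 y.2

/-- Complete positivity: `id_n ⊗ E` preserves positive semidefiniteness for every `n`. -/
def IsCompletelyPositive {A B : Type*} (E : Matrix A A ℂ →ₗ[ℂ] Matrix B B ℂ) : Prop :=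
  ∀ (n : ℕ) (M : Matrix (Fin n × A) (Fin n × A) ℂ),
    M.PosSemidef → (idTensor (Fin n) E M).PosSemidef

/-- A map that preserves the trace. -/
def IsTracePreserving {A B : Type*} [Fintype A] [Fintype B]
    (E : Matrix A A ℂ →ₗ[ℂ] Matrix B B ℂ) : Prop :=
  ∀ ρ : Matrix A A ℂ, (E ρ).trace = ρ.trace

/-- A map that does not increase the trace of positive semidefinite operators. -/
def IsTraceNonincreasing {A B : Type*} [Fintype A] [Fintype B]
    (E : Matrix A A ℂ →ₗ[ℂ] Matrix B B ℂ) : Prop :=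
  ∀ ρ : Matrix A A ℂ, ρ.PosSemidef → (E ρ).trace ≤ ρ.trace

/-- A (quantum) channel: a completely positive trace-preserving linear map. -/
def IsChannel {A B : Type*} [Fintype A] [Fintype B]
    (E : Matrix A A ℂ →ₗ[ℂ] Matrix B B ℂ) : Prop :=
  IsCompletelyPositive E ∧ IsTracePreserving E

/-- An instrument with outcome set `X`: completely positive trace-nonincreasing linear maps
whose sum is a channel. -/
def IsInstrument {A B X : Type*} [Fintype A] [Fintype B] [Fintype X]
    (E : X → Matrix A A ℂ →ₗ[ℂ] Matrix B B ℂ) : Prop :=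
  (∀ a, IsCompletelyPositive (E a)) ∧ (∀ a, IsTraceNonincreasing (E a)) ∧ IsChannel (∑ a, E a)

/-- A quantum state: a positive semidefinite operator of unit trace. -/
def IsState {B : Type*} [Fintype B] (σ : Matrix B B ℂ) : Prop :=
  σ.PosSemidef ∧ σ.trace = 1

/-- A non-interactive instrument: `L_a(ρ) = ∑_l q_l p(a|l) tr(ρ) σ_l`, where `q` is a probability
distribution, `p(·|l)` are conditional probability distributions and `σ_l` are states. -/
def IsNonInteractive {A B X : Type*} [Fintype A] [Fintype B] [Fintype X]
    (L : X → Matrix A A ℂ →ₗ[ℂ] Matrix B B ℂ) : Prop :=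
  ∃ (m : ℕ) (q : Fin m → ℝ) (p : X → Fin m → ℝ) (σ : Fin m → Matrix B B ℂ),
    (∀ l, 0 ≤ q l) ∧ (∑ l, q l = 1) ∧
    (∀ a l, 0 ≤ p a l) ∧ (∀ l, ∑ a, p a l = 1) ∧
    (∀ l, IsState (σ l)) ∧
    ∀ a ρ, L a ρ = ∑ l, (((q l * p a l : ℝ) : ℂ) * ρ.trace) • σ l

/-- The `t ≥ 0` for which `(E + t N) / (1 + t)` is non-interactive for some instrument `N`. -/
def robustnessFeasible {A B X : Type*} [Fintype A] [Fintype B] [Fintype X]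
    (E : X → Matrix A A ℂ →ₗ[ℂ] Matrix B B ℂ) : Set ℝ :=
  {t | 0 ≤ t ∧ ∃ N : X → Matrix A A ℂ →ₗ[ℂ] Matrix B B ℂ, IsInstrument N ∧
    IsNonInteractive fun a => (((1 + t)⁻¹ : ℝ) : ℂ) • (E a + (t : ℂ) • N a)}

/-- The interactive instrument robustness `R(E)`. -/
def robustness {A B X : Type*} [Fintype A] [Fintype B] [Fintype X]
    (E : X → Matrix A A ℂ →ₗ[ℂ] Matrix B B ℂ) : ℝ :=
  sInf (robustnessFeasible E)

/-- The Haar (uniform) probability measure on the unit vectors of `ℂ^A`: the normalised surface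
measure of the unit sphere. -/
def haarPure (A : Type*) [Fintype A] :
    Measure (Metric.sphere (0 : EuclideanSpace ℂ A) 1) :=
  ((volume : Measure (EuclideanSpace ℂ A)).toSphere Set.univ)⁻¹ •
    (volume : Measure (EuclideanSpace ℂ A)).toSphere

/-- The projector `|v⟩⟨v|`. -/
def ketbra {A : Type*} (v : A → ℂ) : Matrix A A ℂ :=
  Matrix.vecMulVec v (star v)

/-- The expectation value `⟨v|M|v⟩` (real part; it is real for Hermitian `M`). -/
def expVal {A : Type*} [Fintype A] (M : Matrix A A ℂ) (v : A → ℂ) : ℝ :=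
  (star v ⬝ᵥ (M *ᵥ v)).re

/-- The Haar average `∫ dψ ⟨ψ| ∑_a (Λ_a ∘ E_a)(|ψ⟩⟨ψ|) |ψ⟩`. -/
def avgFidelity {A B X : Type*} [Fintype A] [Fintype X]
    (E : X → Matrix A A ℂ →ₗ[ℂ] Matrix B B ℂ)
    (Λ : X → Matrix B B ℂ →ₗ[ℂ] Matrix A A ℂ) : ℝ :=
  ∫ ψ : Metric.sphere (0 : EuclideanSpace ℂ A) 1,
    expVal (∑ a, Λ a (E a (ketbra ψ.1.ofLp))) ψ.1.ofLp ∂(haarPure A)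

/-- The average fidelities attained by outcome-dependent recovery channels. -/
def avgFidelityValues {A B X : Type*} [Fintype A] [Fintype B] [Fintype X]
    (E : X → Matrix A A ℂ →ₗ[ℂ] Matrix B B ℂ) : Set ℝ :=
  {x | ∃ Λ : X → Matrix B B ℂ →ₗ[ℂ] Matrix A A ℂ, (∀ a, IsChannel (Λ a)) ∧ x = avgFidelity E Λ}

/-- The optimal average fidelity `F_ave(E)`. -/
def Fave {A B X : Type*} [Fintype A] [Fintype B] [Fintype X]
    (E : X → Matrix A A ℂ →ₗ[ℂ] Matrix B B ℂ) : ℝ :=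
  sSup (avgFidelityValues E)

/-- The maximally entangled vector `|Φ₊⟩ = d_A^{-1/2} ∑_i |i⟩ ⊗ |i⟩`. -/
def maxEntVec (A : Type*) [Fintype A] [DecidableEq A] : A × A → ℂ :=
  fun x => if x.1 = x.2 then (((Real.sqrt (Fintype.card A))⁻¹ : ℝ) : ℂ) else 0

/-- The quantity `∑_a ⟨Φ₊| [id ⊗ (Λ_a ∘ E_a)](|Φ₊⟩⟨Φ₊|) |Φ₊⟩`. -/
def entFidelity {A B X : Type*} [Fintype A] [DecidableEq A] [Fintype X]
    (E : X → Matrix A A ℂ →ₗ[ℂ] Matrix B B ℂ)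
    (Λ : X → Matrix B B ℂ →ₗ[ℂ] Matrix A A ℂ) : ℝ :=
  ∑ a, expVal (idTensor A (Λ a ∘ₗ E a) (ketbra (maxEntVec A))) (maxEntVec A)

/-- The maximally entangled fractions attained by outcome-dependent recovery channels. -/
def entFidelityValues {A B X : Type*} [Fintype A] [DecidableEq A] [Fintype B] [Fintype X]
    (E : X → Matrix A A ℂ →ₗ[ℂ] Matrix B B ℂ) : Set ℝ :=
  {x | ∃ Λ : X → Matrix B B ℂ →ₗ[ℂ] Matrix A A ℂ, (∀ a, IsChannel (Λ a)) ∧ x = entFidelity E Λ}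

/-- The optimal maximally entangled fraction `F₊(E)`. -/
def Fplus {A B X : Type*} [Fintype A] [DecidableEq A] [Fintype B] [Fintype X]
    (E : X → Matrix A A ℂ →ₗ[ℂ] Matrix B B ℂ) : ℝ :=
  sSup (entFidelityValues E)

end

end QInstrument

/-! Write `d` for the dimension of `A`, and `C_a` for the unnormalised Choi matrix of `E a`. Both
optimisations reduce to one family of semidefinite programs, one for each outcome. A recovery
channel becomes an operator `Y ≥ 0` on `A ⊗ B` with `tr_A Y = 1`, and `d² F₊` is the maximum of `∑_a
tr(C_a Y_a)` (`isChannel_iff_recoveryOp`, `entFidelity_eq`). A noise level `t` is feasible iff there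
are `ω_a` with `1 ⊗ ω_a ≥ C_a` and `∑_a tr ω_a = 1 + t` (`mem_robustnessFeasible_iff`). For each `a`
the programs "maximise `tr(C_a Y)`" and "minimise `tr ω`" are dual. Strong duality with attainment
(`exists_strong_duality`) gives a common total value `γ = 1 + R = d² F₊`.

The average fidelity integrates a form of degree four in `ψ`. The fourth moments of the Haar measure
(`haarMoment_eq`) make it an increasing affine function of the entanglement fidelity, `(1 + d F)/(d
+ 1)`, for every choice of recovery (`avgFidelity_eq`). Hence the optimal recoveries coincide and
both identities follow. -/

namespace QInstrument

/-! ### Fourth moments of the uniform measure on the unit sphere. -/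

section Haar

open scoped Pointwise ComplexConjugate

variable {A : Type*} [Fintype A]

/-- The action of a linear isometry on the unit sphere. -/
noncomputable def sphereMap (U : EuclideanSpace ℂ A ≃ₗᵢ[ℝ] EuclideanSpace ℂ A)
    (ψ : Metric.sphere (0 : EuclideanSpace ℂ A) 1) : Metric.sphere (0 : EuclideanSpace ℂ A) 1 :=
  ⟨U ψ.1, by simp⟩

/-- The surface measure of a set is, up to a constant, the volume of the cone over it. An isometry
carries cones to cones and preserves volume. -/
theorem measurePreserving_sphereMap (U : EuclideanSpace ℂ A ≃ₗᵢ[ℝ] EuclideanSpace ℂ A) :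
    MeasurePreserving (sphereMap U) (haarPure A) (haarPure A) := by
  have hm : Measurable (sphereMap U) :=
    (Continuous.subtype_mk (U.continuous.comp continuous_subtype_val) _).measurable
  refine MeasurePreserving.smul_measure (μa := Measure.toSphere volume)
    (μb := Measure.toSphere volume) ⟨hm, ?_⟩ _
  ext s hs
  rw [Measure.map_apply hm hs, Measure.toSphere_apply' _ (hm hs), Measure.toSphere_apply' _ hs]
  congr 1
  rw [← U.measurePreserving.measure_preimage_emb U.toHomeomorph.measurableEmbedding
    (Set.Ioo (0 : ℝ) 1 • (Subtype.val '' s))]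
  congr 1
  ext x
  simp only [Set.mem_smul, Set.mem_image, Set.mem_preimage]
  constructor
  · rintro ⟨r, hr, _, ⟨y, hy, rfl⟩, rfl⟩
    exact ⟨r, hr, _, ⟨_, hy, rfl⟩, by simp [sphereMap]⟩
  · rintro ⟨r, hr, _, ⟨y, hy, rfl⟩, h⟩
    refine ⟨r, hr, _, ⟨sphereMap U.symm y, ?_, rfl⟩, ?_⟩
    · simpa [sphereMap] using hy
    · apply U.injective
      simpa [sphereMap] using h

theorem integral_sphereMap (U : EuclideanSpace ℂ A ≃ₗᵢ[ℝ] EuclideanSpace ℂ A)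
    (f : EuclideanSpace ℂ A → ℂ) (hf : Continuous f) :
    ∫ ψ : Metric.sphere (0 : EuclideanSpace ℂ A) 1, f (U ψ.1) ∂(haarPure A) =
      ∫ ψ : Metric.sphere (0 : EuclideanSpace ℂ A) 1, f ψ.1 ∂(haarPure A) := by
  have h := measurePreserving_sphereMap U
  conv_rhs => rw [← h.map_eq]
  exact (integral_map h.measurable.aemeasurable
    (hf.comp continuous_subtype_val).aestronglyMeasurable).symm

instance [Nonempty A] : IsProbabilityMeasure (haarPure A) := by
  constructor
  rw [haarPure, Measure.smul_apply, smul_eq_mul]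
  refine ENNReal.inv_mul_cancel ?_ (measure_ne_top _ _)
  rw [Measure.toSphere_apply_univ]
  exact mul_ne_zero (Nat.cast_ne_zero.mpr Module.finrank_pos.ne')
    (Metric.measure_ball_pos _ _ one_pos).ne'

theorem integrable_haarPure [Nonempty A] {F : Type*} [NormedAddCommGroup F]
    {f : Metric.sphere (0 : EuclideanSpace ℂ A) 1 → F} (hf : Continuous f) :
    Integrable f (haarPure A) := by
  have : CompactSpace (Metric.sphere (0 : EuclideanSpace ℂ A) 1) :=
    isCompact_iff_compactSpace.mp (isCompact_sphere _ _)
  exact hf.integrable_of_hasCompactSupport (HasCompactSupport.of_compactSpace f)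

/-- The fourth moments `∫ ψ_i ψ̄_j ψ_k ψ̄_l dψ` of a random unit vector. -/
noncomputable def haarMoment (i j k l : A) : ℂ :=
  ∫ ψ : Metric.sphere (0 : EuclideanSpace ℂ A) 1,
    ψ.1 i * conj (ψ.1 j) * ψ.1 k * conj (ψ.1 l) ∂(haarPure A)

/-- Invariance under the diagonal unitary that multiplies coordinate `p` by the phase `I` and fixes
the others. -/
theorem haarMoment_phase [DecidableEq A] (p i j k l : A) :
    haarMoment i j k l =
      (if i = p then Complex.I else 1) * (if j = p then -Complex.I else 1) *
        (if k = p then Complex.I else 1) * (if l = p then -Complex.I else 1) *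
          haarMoment i j k l := by
  let z : A → Circle := fun q => if q = p then Circle.exp (Real.pi / 2) else 1
  have hI : (Circle.exp (Real.pi / 2) : ℂ) = Complex.I := by
    rw [Circle.coe_exp, Complex.exp_mul_I]
    simp
  have hz : ∀ q, (z q : ℂ) = if q = p then Complex.I else 1 := by
    intro q
    by_cases h : q = p
    · simp only [z, h, if_true]; exact hI
    · simp [z, h]
  let U : EuclideanSpace ℂ A ≃ₗᵢ[ℝ] EuclideanSpace ℂ A :=
    LinearIsometryEquiv.piLpCongrRight 2 fun q => rotation (z q)
  have hU : ∀ (ψ : EuclideanSpace ℂ A) q, U ψ q = (if q = p then Complex.I else 1) * ψ q := by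
    intro ψ q
    rw [← hz]
    simp [U]
  conv_lhs => rw [haarMoment]
  rw [← integral_sphereMap U (fun ψ => ψ i * conj (ψ j) * ψ k * conj (ψ l)) (by fun_prop),
    haarMoment, ← integral_const_mul]
  congr 1
  ext ψ
  simp only [hU, map_mul, apply_ite conj, Complex.conj_I, map_one]
  ring

theorem haarMoment_eq_zero {i j k l : A} (h1 : ¬(i = j ∧ k = l)) (h2 : ¬(i = l ∧ k = j)) :
    haarMoment i j k l = 0 := by
  classical
  have key : ∀ {c m : ℂ}, m = c * m → c ≠ 1 → m = 0 := by
    intro c m h hc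
    have : (c - 1) * m = 0 := by linear_combination -h
    exact (mul_eq_zero.mp this).resolve_left (sub_ne_zero.mpr hc)
  have hI1 : Complex.I ≠ 1 := fun h => by simpa using congrArg Complex.im h
  have hI2 : (-1 : ℂ) ≠ 1 := by norm_num
  by_cases hij : i = j ∨ i = l
  -- The phase is put on `k`: the factors of `i` and of its conjugate partner cancel, and the other
  -- conjugated index differs from `k`, so the total factor is `I`.
  · refine key (haarMoment_phase k i j k l) ?_
    rcases hij with rfl | rfl
    · have hkl : l ≠ k := fun h => h1 ⟨rfl, h.symm⟩
      by_cases hk : i = k <;> simp [hk, hkl, hI1]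
    · have hkl : j ≠ k := fun h => h2 ⟨rfl, h.symm⟩
      by_cases hk : i = k <;> simp [hk, hkl, hI1]
  · push Not at hij
    -- Neither conjugated index equals `i`, so the phase on `i` gives `I`, or `I² = -1` when `k =
    -- i`.
    refine key (haarMoment_phase i i j k l) ?_
    by_cases hk : k = i <;> simp [hk, hij.1.symm, hij.2.symm, hI1, hI2]

theorem haarMoment_swap (i j k l : A) : haarMoment i j k l = haarMoment i l k j := by
  unfold haarMoment
  congr 1
  ext ψ
  ring

theorem haarMoment_comm (i j k l : A) : haarMoment i j k l = haarMoment k l i j := by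
  unfold haarMoment
  congr 1
  ext ψ
  ring

theorem integral_quartic [Nonempty A] (c : A → A → A → A → ℂ) :
    ∫ ψ : Metric.sphere (0 : EuclideanSpace ℂ A) 1,
      ∑ i, ∑ j, ∑ k, ∑ l, c i j k l *
        (ψ.1 i * conj (ψ.1 j) * ψ.1 k * conj (ψ.1 l)) ∂(haarPure A) =
      ∑ i, ∑ j, ∑ k, ∑ l, c i j k l * haarMoment i j k l := by
  rw [integral_finsetSum _ fun i _ => integrable_haarPure (by fun_prop)]
  refine Finset.sum_congr rfl fun i _ => ?_
  rw [integral_finsetSum _ fun j _ => integrable_haarPure (by fun_prop)]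
  refine Finset.sum_congr rfl fun j _ => ?_
  rw [integral_finsetSum _ fun k _ => integrable_haarPure (by fun_prop)]
  refine Finset.sum_congr rfl fun k _ => ?_
  rw [integral_finsetSum _ fun l _ => integrable_haarPure (by fun_prop)]
  refine Finset.sum_congr rfl fun l _ => ?_
  rw [integral_const_mul, haarMoment]

theorem sum_mul_sum_mul_sum_mul_sum (a b c d : A → ℂ) :
    (∑ i, a i) * (∑ j, b j) * (∑ k, c k) * (∑ l, d l) =
      ∑ i, ∑ j, ∑ k, ∑ l, a i * b j * c k * d l := by
  simp only [← Finset.mul_sum, ← Finset.sum_mul]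

/-- Phases alone cannot compare different nonzero moments. The reflection fixing the line through `2
e_i + e_k` sends `ψ_i` to `(3 ψ_i + 4 ψ_k)/5`, with rational coefficients. Expanding `|ψ_i|⁴` leaves
`3⁴`, `4⁴` and four mixed terms `3² · 4²`. -/
theorem haarMoment_reflection {i k : A} (hik : i ≠ k) :
    625 * haarMoment i i i i =
      81 * haarMoment i i i i + 256 * haarMoment k k k k + 576 * haarMoment i i k k := by
  classical
  have : Nonempty A := ⟨i⟩
  let u : EuclideanSpace ℂ A := EuclideanSpace.single i 2 + EuclideanSpace.single k 1
  let U : EuclideanSpace ℂ A ≃ₗᵢ[ℝ] EuclideanSpace ℂ A :=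
    { ((Submodule.span ℂ {u}).reflection.toLinearEquiv.restrictScalars ℝ) with
      norm_map' := fun x => (Submodule.span ℂ {u}).reflection.norm_map x }
  let f : A → ℂ := fun q => (if q = i then 3 / 5 else 0) + (if q = k then 4 / 5 else 0)
  have hn : (‖u‖ : ℂ) ^ 2 = 5 := by
    have : ‖u‖ ^ 2 = 5 := by
      have hi : ‖u i‖ = 2 := by simp [u, hik]
      have hk : ‖u k‖ = 1 := by simp [u, hik.symm]
      rw [EuclideanSpace.norm_sq_eq, Finset.sum_eq_add i k hik, hi, hk]
      · norm_num
      · intro c _ hc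
        simp [u, hc.1, hc.2]
      · simp
      · simp
    exact_mod_cast this
  have hU : ∀ ψ : EuclideanSpace ℂ A, U ψ i = ∑ q, f q * ψ q := by
    intro ψ
    have h1 : U ψ = (Submodule.span ℂ {u}).reflection ψ := rfl
    have h2 : inner ℂ u ψ = 2 * ψ i + ψ k := by
      simp only [u, inner_add_left, EuclideanSpace.inner_single_left, map_ofNat, map_one, one_mul]
    rw [h1, Submodule.reflection_singleton_apply, h2]
    simp only [f, add_mul, Finset.sum_add_distrib, ite_mul, zero_mul, Finset.sum_ite_eq',
      Finset.mem_univ, if_true]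
    have hui : u i = 2 := by simp [u, hik]
    simp only [two_smul, PiLp.sub_apply, PiLp.add_apply, PiLp.smul_apply, smul_eq_mul, hui]
    simp only [hn, Complex.coe_algebraMap]
    ring
  have h := integral_sphereMap U (fun ψ => ψ i * conj (ψ i) * ψ i * conj (ψ i)) (by fun_prop)
  have hf : ∀ q, conj (f q) = f q := by
    intro q
    simp only [f, map_add, apply_ite conj, map_div₀, map_zero, map_ofNat]
  have hq : ∀ ψ : Metric.sphere (0 : EuclideanSpace ℂ A) 1,
      U ψ.1 i * conj (U ψ.1 i) * U ψ.1 i * conj (U ψ.1 i) =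
      ∑ q, ∑ r, ∑ s, ∑ t, (f q * f r * f s * f t) *
        (ψ.1 q * conj (ψ.1 r) * ψ.1 s * conj (ψ.1 t)) := by
    intro ψ
    simp only [hU, map_sum, map_mul, hf]
    rw [sum_mul_sum_mul_sum_mul_sum]
    refine Finset.sum_congr rfl fun q _ => Finset.sum_congr rfl fun r _ =>
      Finset.sum_congr rfl fun s _ => Finset.sum_congr rfl fun t _ => by ring
  simp only [hq] at h
  rw [integral_quartic] at h
  change _ = haarMoment i i i i at h
  have hz : ∀ {a b c d : A}, (¬(a = b ∧ c = d)) → (¬(a = d ∧ c = b)) → haarMoment a b c d = 0 :=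
    haarMoment_eq_zero
  simp only [f, add_mul, mul_add, Finset.sum_add_distrib, ite_mul, mul_ite, mul_zero, zero_mul,
    Finset.sum_ite_eq', Finset.mem_univ, if_true] at h
  have e1 : haarMoment i k k i = haarMoment i i k k := haarMoment_swap _ _ _ _
  have e2 : haarMoment k k i i = haarMoment i i k k := haarMoment_comm _ _ _ _
  have e3 : haarMoment k i i k = haarMoment i i k k := by rw [haarMoment_swap, e2]
  rw [e1, e2, e3, hz (a := k) (b := i) (c := i) (d := i) (by simp [hik.symm]) (by simp [hik.symm]),
    hz (a := i) (b := k) (c := i) (d := i) (by simp [hik]) (by simp [hik]),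
    hz (a := i) (b := i) (c := k) (d := i) (by simp [hik.symm]) (by simp [hik.symm]),
    hz (a := k) (b := i) (c := k) (d := i) (by simp [hik.symm]) (by simp [hik.symm]),
    hz (a := k) (b := k) (c := k) (d := i) (by simp [hik.symm]) (by simp [hik.symm]),
    hz (a := i) (b := i) (c := i) (d := k) (by simp [hik]) (by simp [hik]),
    hz (a := i) (b := k) (c := i) (d := k) (by simp [hik]) (by simp [hik]),
    hz (a := k) (b := k) (c := i) (d := k) (by simp [hik]) (by simp [hik]),
    hz (a := k) (b := i) (c := k) (d := k) (by simp [hik.symm]) (by simp [hik.symm]),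
    hz (a := i) (b := k) (c := k) (d := k) (by simp [hik]) (by simp [hik])] at h
  linear_combination (-625) * h

/-- The fourth moments of the Haar measure on the unit sphere. -/
theorem haarMoment_eq [DecidableEq A] [Nonempty A] (i j k l : A) :
    haarMoment i j k l =
      ((if i = j ∧ k = l then 1 else 0) + (if i = l ∧ k = j then 1 else 0)) /
        (Fintype.card A * (Fintype.card A + 1)) := by
  -- The reflection identity and its copy with `i`, `k` exchanged: their difference equates the two
  -- diagonal moments, and then either one fixes the mixed moment.
  have hrel : ∀ {i k : A}, i ≠ k → haarMoment i i i i = haarMoment k k k k ∧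
      2 * haarMoment i i k k = haarMoment i i i i := by
    intro i k hik
    have h1 := haarMoment_reflection hik
    have h2 := haarMoment_reflection hik.symm
    rw [haarMoment_comm k k i i] at h2
    constructor
    · linear_combination (h1 - h2) / 800
    · linear_combination -h1 / 288 + 256 / 288 * (h1 - h2) / 800
  let o := Classical.arbitrary A
  set α := haarMoment o o o o
  have hdiag : ∀ i : A, haarMoment i i i i = α := by
    intro i
    by_cases h : i = o
    · rw [h]
    · exact (hrel h).1
  have hβ : ∀ i k : A, haarMoment i i k k = α / 2 + if i = k then α / 2 else 0 := by
    intro i k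
    by_cases h : i = k
    · subst h; rw [hdiag, if_pos rfl]; ring
    · rw [if_neg h, add_zero, ← hdiag i, ← (hrel h).2]; ring
  -- The normalisation comes from integrating `‖ψ‖⁴ = 1`.
  have hsum : ∑ i : A, ∑ k : A, haarMoment i i k k = 1 := by
    have h := integral_quartic (A := A) fun i j k l => if i = j then if k = l then 1 else 0 else 0
    simp only [ite_mul, one_mul, zero_mul, Finset.sum_ite_eq, Finset.mem_univ, if_true,
      Finset.sum_ite_irrel, Finset.sum_const_zero] at h
    rw [← h]
    have h1 : ∀ ψ : Metric.sphere (0 : EuclideanSpace ℂ A) 1,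
        ∑ i : A, ∑ k : A, ψ.1 i * conj (ψ.1 i) * ψ.1 k * conj (ψ.1 k) = 1 := by
      intro ψ
      have hn : ∑ i : A, ψ.1 i * conj (ψ.1 i) = 1 := by
        have : ∑ i : A, ‖ψ.1 i‖ ^ 2 = 1 := by
          rw [← EuclideanSpace.norm_sq_eq, norm_eq_of_mem_sphere ψ, one_pow]
        simp only [Complex.mul_conj']
        exact_mod_cast this
      calc _ = (∑ i : A, ψ.1 i * conj (ψ.1 i)) * ∑ k : A, ψ.1 k * conj (ψ.1 k) := by
            rw [Finset.sum_mul_sum]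
            simp only [mul_assoc]
        _ = 1 := by rw [hn, one_mul]
    simp only [h1, integral_const, probReal_univ, one_smul]
  have hd : (Fintype.card A : ℂ) ≠ 0 := Nat.cast_ne_zero.mpr Fintype.card_ne_zero
  have hd1 : (Fintype.card A : ℂ) + 1 ≠ 0 := Nat.cast_add_one_ne_zero _
  have hα : α / 2 = 1 / (Fintype.card A * (Fintype.card A + 1)) := by
    simp only [hβ, Finset.sum_add_distrib, Finset.sum_const, Finset.sum_ite_eq, Finset.mem_univ,
      if_true, Finset.card_univ, nsmul_eq_mul] at hsum
    rw [eq_div_iff (mul_ne_zero hd hd1)]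
    linear_combination hsum
  by_cases h1 : i = j ∧ k = l
  · obtain ⟨rfl, rfl⟩ := h1
    rw [hβ, hα]
    by_cases hik : i = k
    · subst hik
      simp only [and_self, if_true]
      ring
    · simp [hik]
  · by_cases h2 : i = l ∧ k = j
    · obtain ⟨rfl, rfl⟩ := h2
      have hik : i ≠ k := fun h => h1 ⟨h, h.symm⟩
      rw [haarMoment_swap, hβ, hα]
      simp [hik]
    · rw [haarMoment_eq_zero h1 h2, if_neg h1, if_neg h2]
      simp

/-- The Haar average of a quartic form. -/
theorem integral_haarPure_quartic [Nonempty A] (c : A → A → A → A → ℂ) :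
    ∫ ψ : Metric.sphere (0 : EuclideanSpace ℂ A) 1,
      ∑ i, ∑ j, ∑ k, ∑ l, c i j k l *
        (ψ.1 i * conj (ψ.1 j) * ψ.1 k * conj (ψ.1 l)) ∂(haarPure A) =
      (∑ i, ∑ k, c i i k k + ∑ i, ∑ j, c i j j i) /
        (Fintype.card A * (Fintype.card A + 1)) := by
  classical
  rw [integral_quartic, ← Finset.sum_add_distrib, Finset.sum_div]
  refine Finset.sum_congr rfl fun i _ => ?_
  have h : ∀ j k l, c i j k l * haarMoment i j k l =
      (if i = j then if k = l then c i j k l else 0 else 0) /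
        (Fintype.card A * (Fintype.card A + 1)) +
      (if i = l then if k = j then c i j k l else 0 else 0) /
        (Fintype.card A * (Fintype.card A + 1)) := by
    intro j k l
    rw [haarMoment_eq, ite_and, ite_and]
    split_ifs <;> ring
  simp only [h, Finset.sum_add_distrib, ← Finset.sum_div, add_div]
  congr 2
  · rw [Finset.sum_eq_single i (by simp +contextual [eq_comm]) (by simp)]
    simp
  · simp

end Haar

/-! ### Choi matrices, and average fidelity in terms of entanglement fidelity. -/

section Choi

open scoped ComplexConjugate

theorem exists_eq_mul_conjTranspose {n : Type*} [Fintype n] {M : Matrix n n ℂ}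
    (hM : M.PosSemidef) : ∃ P : Matrix n n ℂ, M = P * Pᴴ := by
  classical
  open scoped MatrixOrder in
  obtain ⟨P, rfl⟩ := CStarAlgebra.nonneg_iff_eq_star_mul_self.mp hM.nonneg
  exact ⟨star P, by simp [star_eq_conjTranspose]⟩

variable {A B X : Type*}

section Map

variable [DecidableEq A]

/-- The (unnormalised) Choi matrix of a linear map. -/
def choi (E : Matrix A A ℂ →ₗ[ℂ] Matrix B B ℂ) : Matrix (A × B) (A × B) ℂ :=
  Matrix.of fun x y => E (Matrix.single x.1 y.1 1) x.2 y.2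

theorem choi_sum [Fintype X] (E : X → Matrix A A ℂ →ₗ[ℂ] Matrix B B ℂ) :
    choi (∑ a, E a) = ∑ a, choi (E a) := by
  ext x y
  simp [choi, Matrix.sum_apply]

variable [Fintype A]

/-- The linear map with a given Choi matrix. -/
def ofChoi (D : Matrix (A × B) (A × B) ℂ) : Matrix A A ℂ →ₗ[ℂ] Matrix B B ℂ where
  toFun ρ := Matrix.of fun b b' => ∑ i, ∑ j, ρ i j * D (i, b) (j, b')
  map_add' ρ σ := by
    ext b b'
    simp [add_mul, Finset.sum_add_distrib]
  map_smul' c ρ := by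
    ext b b'
    simp [Finset.mul_sum, mul_assoc]

theorem choi_ofChoi (D : Matrix (A × B) (A × B) ℂ) : choi (ofChoi D) = D := by
  ext ⟨i, b⟩ ⟨j, b'⟩
  simp [choi, ofChoi, Matrix.single_apply, ite_and]

theorem ofChoi_choi (E : Matrix A A ℂ →ₗ[ℂ] Matrix B B ℂ) : ofChoi (choi E) = E := by
  ext ρ b b'
  conv_rhs => rw [matrix_eq_sum_single ρ]
  simp only [ofChoi, choi, LinearMap.coe_mk, AddHom.coe_mk, of_apply, map_sum, Matrix.sum_apply]
  refine Finset.sum_congr rfl fun i _ => Finset.sum_congr rfl fun j _ => ?_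
  have : Matrix.single i j (ρ i j) = ρ i j • Matrix.single i j (1 : ℂ) := by simp
  rw [this, map_smul, Matrix.smul_apply, smul_eq_mul]

theorem apply_eq_sum_choi (E : Matrix A A ℂ →ₗ[ℂ] Matrix B B ℂ) (ρ : Matrix A A ℂ) (b b' : B) :
    E ρ b b' = ∑ i, ∑ j, ρ i j * choi E (i, b) (j, b') := by
  conv_lhs => rw [← ofChoi_choi E]
  rfl

theorem choi_injective :
    Function.Injective (choi : (Matrix A A ℂ →ₗ[ℂ] Matrix B B ℂ) → _) :=
  Function.LeftInverse.injective ofChoi_choi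

end Map

/-- `∑_{ij} ⟨i|T(|i⟩⟨j|)|j⟩`, that is `d_A²` times the entanglement fidelity of `T`. -/
def entPairing [Fintype A] [DecidableEq A] (T : Matrix A A ℂ →ₗ[ℂ] Matrix A A ℂ) : ℂ :=
  ∑ i, ∑ j, T (Matrix.single i j 1) i j

theorem IsCompletelyPositive.posSemidef_apply {E : Matrix A A ℂ →ₗ[ℂ] Matrix B B ℂ}
    (hE : IsCompletelyPositive E) {ρ : Matrix A A ℂ} (hρ : ρ.PosSemidef) : (E ρ).PosSemidef :=
  (hE 1 _ (hρ.submatrix Prod.snd)).submatrix fun b => ((0 : Fin 1), b)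

theorem expVal_maxEntVec [Fintype A] [DecidableEq A] (T : Matrix A A ℂ →ₗ[ℂ] Matrix A A ℂ) :
    expVal (idTensor A T (ketbra (maxEntVec A))) (maxEntVec A) =
      (entPairing T).re / (Fintype.card A : ℝ) ^ 2 := by
  set c : ℝ := (Real.sqrt (Fintype.card A))⁻¹ with hc
  have hcc : c * c = (Fintype.card A : ℝ)⁻¹ := by
    rw [hc, ← mul_inv, Real.mul_self_sqrt (Nat.cast_nonneg _)]
  have hv : ∀ i k, maxEntVec A (i, k) = if i = k then (c : ℂ) else 0 := fun _ _ => rfl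
  have hM : ∀ i k j l, idTensor A T (ketbra (maxEntVec A)) (i, k) (j, l) =
      (c * c : ℂ) * T (Matrix.single i j 1) k l := by
    intro i k j l
    rw [← smul_eq_mul, ← Matrix.smul_apply, ← map_smul]
    simp only [idTensor, of_apply]
    refine congrFun (congrFun (congrArg T ?_) k) l
    ext a a'
    by_cases h1 : i = a <;> by_cases h2 : j = a' <;>
      simp [ketbra, vecMulVec_apply, hv, h1, h2]
  have : star (maxEntVec A) ⬝ᵥ (idTensor A T (ketbra (maxEntVec A)) *ᵥ maxEntVec A) =
      ((c * c * (c * c) : ℝ) : ℂ) * entPairing T := by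
    simp only [dotProduct, mulVec, Fintype.sum_prod_type, hM, hv, Pi.star_apply, apply_ite star,
      star_zero, ite_mul, mul_ite, mul_zero, zero_mul, Finset.sum_ite_irrel,
      Finset.sum_const_zero, Finset.sum_ite_eq, Finset.mem_univ, if_true,
      entPairing, Finset.mul_sum, Complex.star_def, Complex.conj_ofReal]
    refine Finset.sum_congr rfl fun i _ => Finset.sum_congr rfl fun j _ => ?_
    push_cast
    ring
  rw [expVal, this, Complex.re_ofReal_mul, hcc]
  ring

variable [Fintype A] [Fintype B]

variable [DecidableEq A]

/-- Choi's theorem. -/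
theorem isCompletelyPositive_iff_choi (E : Matrix A A ℂ →ₗ[ℂ] Matrix B B ℂ) :
    IsCompletelyPositive E ↔ (choi E).PosSemidef := by
  constructor
  · intro h
    -- The Choi matrix is, up to relabelling, the image of the unnormalised maximally entangled
    -- projector with a reference system of dimension `card A`.
    let e : Fin (Fintype.card A) ≃ A := (Fintype.equivFin A).symm
    let v : Fin (Fintype.card A) × A → ℂ := fun x => if e x.1 = x.2 then 1 else 0
    have h1 := (h _ _ (posSemidef_vecMulVec_self_star v)).submatrix
      fun x : A × B => (e.symm x.1, x.2)
    convert h1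
    ext ⟨i, b⟩ ⟨j, b'⟩
    simp only [choi, of_apply, submatrix_apply, idTensor]
    refine congrFun (congrFun (congrArg E ?_) b) b'
    ext a a'
    simp [v, Matrix.single_apply, vecMulVec_apply, ← ite_and, and_comm]
  · intro h n M hM
    obtain ⟨Q, rfl⟩ := exists_eq_mul_conjTranspose hM
    obtain ⟨P, hP⟩ := exists_eq_mul_conjTranspose h
    -- Contracting the factors `Q` of the input and `P` of the Choi matrix over `A` exhibits the
    -- output as `W * Wᴴ`.
    let W : Matrix (Fin n × B) ((Fin n × A) × (A × B)) ℂ :=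
      Matrix.of fun x y => ∑ i, Q (x.1, i) y.1 * P (i, x.2) y.2
    have : idTensor (Fin n) E (Q * Qᴴ) = W * Wᴴ := by
      ext ⟨r, b⟩ ⟨s, b'⟩
      simp only [idTensor, of_apply, apply_eq_sum_choi, hP, Matrix.mul_apply, conjTranspose_apply,
        W, star_sum, star_mul', Finset.sum_mul_sum]
      symm
      rw [Finset.sum_comm]
      refine Finset.sum_congr rfl fun i _ => ?_
      rw [Finset.sum_comm]
      refine Finset.sum_congr rfl fun j _ => ?_
      rw [Fintype.sum_prod_type]
      exact Finset.sum_congr rfl fun p _ => Finset.sum_congr rfl fun q _ => by ring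
    rw [this]
    exact posSemidef_self_mul_conjTranspose W

theorem isTracePreserving_iff_choi (E : Matrix A A ℂ →ₗ[ℂ] Matrix B B ℂ) :
    IsTracePreserving E ↔ ∀ i j, ∑ b, choi E (i, b) (j, b) = (1 : Matrix A A ℂ) i j := by
  constructor
  · intro h i j
    refine (h (Matrix.single i j 1)).trans ?_
    by_cases hij : i = j
    · rw [hij, Matrix.trace_single_eq_same, Matrix.one_apply_eq]
    · rw [Matrix.trace_single_eq_of_ne _ _ _ hij, Matrix.one_apply_ne hij]
  · intro h ρ
    simp only [Matrix.trace, diag_apply, apply_eq_sum_choi]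
    rw [Finset.sum_comm]
    refine Finset.sum_congr rfl fun i _ => ?_
    rw [Finset.sum_comm]
    simp [← Finset.mul_sum, h, Matrix.one_apply]

/-- Trace non-increase is automatic: each outcome's trace is one of the nonnegative terms whose sum
is the input trace. -/
theorem isInstrument_of_isCompletelyPositive [Fintype X]
    {E : X → Matrix A A ℂ →ₗ[ℂ] Matrix B B ℂ} (h : ∀ a, IsCompletelyPositive (E a))
    (ht : IsTracePreserving (∑ a, E a)) : IsInstrument E := by
  refine ⟨h, fun a ρ hρ => ?_, ?_, ht⟩
  · rw [← ht ρ, LinearMap.sum_apply, Matrix.trace_sum]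
    exact Finset.single_le_sum (f := fun a => (E a ρ).trace)
      (fun a _ => ((h a).posSemidef_apply hρ).trace_nonneg) (Finset.mem_univ a)
  · rw [isCompletelyPositive_iff_choi, choi_sum]
    exact posSemidef_sum _ fun a _ => (isCompletelyPositive_iff_choi _).mp (h a)

theorem entPairing_comp [DecidableEq B] (E : Matrix A A ℂ →ₗ[ℂ] Matrix B B ℂ)
    (Λ : Matrix B B ℂ →ₗ[ℂ] Matrix A A ℂ) :
    entPairing (Λ ∘ₗ E) = ∑ x, ∑ y, choi E x y * choi Λ x.swap y.swap := by
  simp only [entPairing, LinearMap.comp_apply, apply_eq_sum_choi Λ, Fintype.sum_prod_type]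
  refine Finset.sum_congr rfl fun i _ => ?_
  rw [Finset.sum_comm]
  refine Finset.sum_congr rfl fun b _ => ?_
  rfl

/-- The Haar average of a quartic form keeps two index pairings. One gives `∑_i tr T(|i⟩⟨i|) = d` by
trace preservation, the other gives `entPairing T = d² F`; their sum is divided by `d(d+1)`. -/
theorem avgFidelity_eq [Nonempty A] [Fintype X] {E : X → Matrix A A ℂ →ₗ[ℂ] Matrix B B ℂ}
    (hE : IsTracePreserving (∑ a, E a)) {Λ : X → Matrix B B ℂ →ₗ[ℂ] Matrix A A ℂ}
    (hΛ : ∀ a, IsTracePreserving (Λ a)) :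
    avgFidelity E Λ = (1 + Fintype.card A * entFidelity E Λ) / (Fintype.card A + 1) := by
  let T : Matrix A A ℂ →ₗ[ℂ] Matrix A A ℂ := ∑ a, Λ a ∘ₗ E a
  have hT : IsTracePreserving T := by
    intro ρ
    rw [← hE ρ]
    simp only [T, LinearMap.sum_apply, Matrix.trace_sum, LinearMap.comp_apply]
    exact Finset.sum_congr rfl fun a _ => hΛ a _
  have hd : (Fintype.card A : ℝ) ≠ 0 := Nat.cast_ne_zero.mpr Fintype.card_ne_zero
  have hd1 : (Fintype.card A : ℝ) + 1 ≠ 0 := Nat.cast_add_one_ne_zero _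
  have hent : entFidelity E Λ = (entPairing T).re / (Fintype.card A : ℝ) ^ 2 := by
    simp only [entFidelity, expVal_maxEntVec, ← Finset.sum_div]
    congr 1
    simp only [← Complex.re_sum, entPairing, T, LinearMap.sum_apply, Matrix.sum_apply]
    rw [Finset.sum_comm]
    congr 1
    exact Finset.sum_congr rfl fun i _ => Finset.sum_comm
  have hpt : ∀ ψ : Metric.sphere (0 : EuclideanSpace ℂ A) 1,
      expVal (∑ a, Λ a (E a (ketbra ψ.1.ofLp))) ψ.1.ofLp =
        RCLike.re (∑ i, ∑ j, ∑ k, ∑ l, T (Matrix.single i j 1) l k *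
          (ψ.1 i * conj (ψ.1 j) * ψ.1 k * conj (ψ.1 l))) := by
    intro ψ
    have : ∑ a, Λ a (E a (ketbra ψ.1.ofLp)) = T (ketbra ψ.1.ofLp) := by
      simp [T, LinearMap.sum_apply]
    rw [this, expVal]
    have hk : ∀ b b', T (ketbra ψ.1.ofLp) b b' =
        ∑ i, ∑ j, ψ.1 i * conj (ψ.1 j) * T (Matrix.single i j 1) b b' :=
      fun b b' => apply_eq_sum_choi T _ b b'
    simp only [dotProduct, mulVec, hk, Pi.star_apply,
      Finset.sum_mul, Finset.mul_sum]
    change Complex.re _ = Complex.re _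
    congr 1
    rw [Finset.sum_comm]
    calc _ = ∑ k, ∑ l, ∑ i, ∑ j, T (Matrix.single i j 1) l k *
          (ψ.1 i * conj (ψ.1 j) * ψ.1 k * conj (ψ.1 l)) := by
          refine Finset.sum_congr rfl fun k _ => Finset.sum_congr rfl fun l _ =>
            Finset.sum_congr rfl fun i _ => Finset.sum_congr rfl fun j _ => ?_
          rw [Complex.star_def]
          ring
      _ = ∑ k, ∑ i, ∑ j, ∑ l, T (Matrix.single i j 1) l k *
          (ψ.1 i * conj (ψ.1 j) * ψ.1 k * conj (ψ.1 l)) := by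
          refine Finset.sum_congr rfl fun k _ => ?_
          rw [Finset.sum_comm]
          exact Finset.sum_congr rfl fun i _ => Finset.sum_comm
      _ = _ := by
          rw [Finset.sum_comm]
          exact Finset.sum_congr rfl fun i _ => Finset.sum_comm
  have hint := integral_re (𝕜 := ℂ) (μ := haarPure A)
    (f := fun ψ => ∑ i, ∑ j, ∑ k, ∑ l, T (Matrix.single i j 1) l k *
          (ψ.1 i * conj (ψ.1 j) * ψ.1 k * conj (ψ.1 l))) (integrable_haarPure (by fun_prop))
  rw [avgFidelity]
  simp only [hpt]
  rw [hint, integral_haarPure_quartic]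
  have h1 : ∑ i, ∑ k, T (Matrix.single i i 1) k k = (Fintype.card A : ℂ) := by
    have : ∀ i, ∑ k, T (Matrix.single i i 1) k k = 1 := by
      intro i
      have := hT (Matrix.single i i 1)
      rwa [Matrix.trace_single_eq_same] at this
    simp [this]
  rw [h1, hent]
  change (((Fintype.card A : ℂ) + entPairing T) / _).re = _
  have : ((Fintype.card A : ℂ) * (Fintype.card A + 1)) =
    (((Fintype.card A : ℝ) * (Fintype.card A + 1) : ℝ) : ℂ) := by push_cast; rfl
  rw [this, Complex.div_ofReal_re, Complex.add_re, Complex.natCast_re]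
  field_simp

end Choi

/-! ### Strong duality for the semidefinite program of a single outcome. -/

section Duality

open scoped Kronecker

variable {A B : Type*} [Fintype A]

/-- The partial trace over the first tensor factor. -/
def ptrace (M : Matrix (A × B) (A × B) ℂ) : Matrix B B ℂ :=
  ∑ i, M.submatrix (Prod.mk i) (Prod.mk i)

theorem ptrace_apply (M : Matrix (A × B) (A × B) ℂ) (b b' : B) :
    ptrace M b b' = ∑ i, M (i, b) (i, b') := by
  simp [ptrace, Matrix.sum_apply]

theorem ptrace_add (M N : Matrix (A × B) (A × B) ℂ) : ptrace (M + N) = ptrace M + ptrace N := by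
  ext; simp [ptrace_apply, Finset.sum_add_distrib]

theorem ptrace_smul (c : ℂ) (M : Matrix (A × B) (A × B) ℂ) :
    ptrace (c • M) = c • ptrace M := by
  ext; simp [ptrace_apply, Finset.mul_sum]

theorem ptrace_conjTranspose (M : Matrix (A × B) (A × B) ℂ) : ptrace Mᴴ = (ptrace M)ᴴ := by
  ext; simp [ptrace_apply]

theorem posSemidef_ptrace {M : Matrix (A × B) (A × B) ℂ} (hM : M.PosSemidef) :
    (ptrace M).PosSemidef :=
  posSemidef_sum _ fun _ _ => hM.submatrix _

theorem ptrace_one_kronecker [DecidableEq A] (S : Matrix B B ℂ) :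
    ptrace ((1 : Matrix A A ℂ) ⊗ₖ S) = (Fintype.card A : ℂ) • S := by
  ext b b'
  simp [ptrace_apply, kroneckerMap_apply]

variable [Fintype B]

theorem trace_ptrace (M : Matrix (A × B) (A × B) ℂ) : (ptrace M).trace = M.trace := by
  simp only [Matrix.trace, diag_apply, ptrace_apply, Fintype.sum_prod_type]
  exact Finset.sum_comm

theorem trace_mul_nonneg {n : Type*} [Fintype n] {M N : Matrix n n ℂ} (hM : M.PosSemidef)
    (hN : N.PosSemidef) : 0 ≤ (M * N).trace := by
  obtain ⟨P, rfl⟩ := exists_eq_mul_conjTranspose hM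
  rw [mul_assoc, Matrix.trace_mul_comm]
  exact (hN.conjTranspose_mul_mul_same P).trace_nonneg

variable [DecidableEq A]

theorem posSemidef_one_kronecker {S : Matrix B B ℂ} (hS : S.PosSemidef) :
    ((1 : Matrix A A ℂ) ⊗ₖ S).PosSemidef := by
  classical
  exact PosSemidef.one.kronecker hS

theorem ptrace_kronecker_mul (S : Matrix B B ℂ) (M : Matrix (A × B) (A × B) ℂ) :
    ptrace (((1 : Matrix A A ℂ) ⊗ₖ S) * M) = S * ptrace M := by
  ext b b'
  simp only [ptrace_apply, Matrix.mul_apply, Fintype.sum_prod_type, kroneckerMap_apply,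
    Matrix.one_apply, ite_mul, one_mul, zero_mul, Finset.sum_ite_irrel, Finset.sum_const_zero,
    Finset.sum_ite_eq, Finset.mem_univ, if_true, Finset.mul_sum]
  exact Finset.sum_comm

theorem ptrace_mul_kronecker (M : Matrix (A × B) (A × B) ℂ) (S : Matrix B B ℂ) :
    ptrace (M * ((1 : Matrix A A ℂ) ⊗ₖ S)) = ptrace M * S := by
  have h := congrArg conjTranspose (ptrace_kronecker_mul Sᴴ Mᴴ)
  rw [← ptrace_conjTranspose] at h
  simpa [conjTranspose_mul, conjTranspose_kronecker, ptrace_conjTranspose] using h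

/-- Weak duality for the conditional min-entropy program. -/
theorem trace_mul_le_of_le_one_kronecker [DecidableEq B] {C Y : Matrix (A × B) (A × B) ℂ}
    {ω : Matrix B B ℂ}
    (hY : Y.PosSemidef) (hY1 : ptrace Y = 1) (hω : ((1 : Matrix A A ℂ) ⊗ₖ ω - C).PosSemidef) :
    (C * Y).trace ≤ ω.trace := by
  have h := trace_mul_nonneg hω hY
  rw [sub_mul, Matrix.trace_sub, ← trace_ptrace (_ * Y), ptrace_kronecker_mul, hY1, mul_one] at h
  exact sub_nonneg.mp h

/-- With `Y = P * Pᴴ` positivity is built in, and the constraint fixes the Frobenius norm of `P`,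
since `tr(P * Pᴴ) = dim B`. The maximum is thus taken of a continuous function on a compact set. -/
theorem exists_isMaxOn_trace_mul [DecidableEq B] [Nonempty A] (C : Matrix (A × B) (A × B) ℂ) :
    ∃ Y : Matrix (A × B) (A × B) ℂ, Y.PosSemidef ∧ ptrace Y = 1 ∧
      ∀ Z : Matrix (A × B) (A × B) ℂ, Z.PosSemidef → ptrace Z = 1 →
        (C * Z).trace.re ≤ (C * Y).trace.re := by
  let K : Set (Matrix (A × B) (A × B) ℂ) := {P | ptrace (P * Pᴴ) = 1}
  have hK : IsCompact K := by
    have hc : IsClosed K := by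
      refine isClosed_eq ?_ continuous_const
      unfold ptrace
      fun_prop
    refine IsCompact.of_isClosed_subset (isCompact_univ_pi fun x : A × B =>
      isCompact_univ_pi fun y : A × B =>
        isCompact_closedBall (0 : ℂ) (Real.sqrt (Fintype.card B))) hc ?_
    intro P hP
    refine Set.mem_univ_pi.mpr fun x => Set.mem_univ_pi.mpr fun y =>
      mem_closedBall_zero_iff.mpr ?_
    have htr : (P * Pᴴ).trace = Fintype.card B := by
      rw [← trace_ptrace, show ptrace (P * Pᴴ) = 1 from hP, Matrix.trace_one]
    have hsum : ∑ x, ∑ y, ‖P x y‖ ^ 2 = Fintype.card B := by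
      have : (P * Pᴴ).trace = ((∑ x, ∑ y, ‖P x y‖ ^ 2 : ℝ) : ℂ) := by
        simp [Matrix.trace, Matrix.mul_apply, Complex.mul_conj']
      rw [this] at htr
      exact_mod_cast htr
    refine Real.le_sqrt_of_sq_le ?_
    rw [← hsum]
    calc ‖P x y‖ ^ 2 ≤ ∑ y, ‖P x y‖ ^ 2 :=
          Finset.single_le_sum (f := fun y => ‖P x y‖ ^ 2) (fun _ _ => sq_nonneg _)
            (Finset.mem_univ y)
      _ ≤ _ := Finset.single_le_sum (f := fun x => ∑ y, ‖P x y‖ ^ 2)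
            (fun _ _ => Finset.sum_nonneg fun _ _ => sq_nonneg _) (Finset.mem_univ x)
  have hd : (Fintype.card A : ℂ) ≠ 0 := Nat.cast_ne_zero.mpr Fintype.card_ne_zero
  have hne : K.Nonempty := by
    have h0 : (((Fintype.card A : ℂ)⁻¹) • ((1 : Matrix A A ℂ) ⊗ₖ (1 : Matrix B B ℂ))).PosSemidef :=
      (posSemidef_one_kronecker PosSemidef.one).smul (by positivity)
    obtain ⟨P, hP⟩ := exists_eq_mul_conjTranspose h0
    refine ⟨P, ?_⟩
    change ptrace (P * Pᴴ) = 1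
    rw [← hP, ptrace_smul, ptrace_one_kronecker, smul_smul, inv_mul_cancel₀ hd, one_smul]
  obtain ⟨P, hP, hmax⟩ := hK.exists_isMaxOn hne
    (f := fun P => (C * (P * Pᴴ)).trace.re) (by fun_prop)
  refine ⟨P * Pᴴ, posSemidef_self_mul_conjTranspose P, hP, fun Z hZ hZ1 => ?_⟩
  obtain ⟨Q, rfl⟩ := exists_eq_mul_conjTranspose hZ
  exact hmax hZ1

/-- Extracts the first-order optimality condition from a one-sided perturbation: divide by `ε` and
let it tend to zero. -/
theorem nonpos_of_cubic_nonpos {a b c δ : ℝ} (hδ : 0 < δ)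
    (h : ∀ ε : ℝ, 0 < ε → ε ≤ δ → ε * a + ε ^ 2 * b + ε ^ 3 * c ≤ 0) : a ≤ 0 := by
  have ht : Filter.Tendsto (fun ε : ℝ => a + ε * b + ε ^ 2 * c) (nhdsWithin 0 (Set.Ioi 0))
      (nhds a) := by
    have : ContinuousAt (fun ε : ℝ => a + ε * b + ε ^ 2 * c) 0 := by fun_prop
    simpa using this.tendsto.mono_left nhdsWithin_le_nhds
  refine le_of_tendsto ht ?_
  filter_upwards [Ioc_mem_nhdsGT hδ] with ε hε
  have h1 := h ε hε.1 hε.2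
  have h2 : ε * (a + ε * b + ε ^ 2 * c) ≤ 0 := by linarith
  exact nonpos_of_mul_nonpos_right h2 hε.1

theorem exists_smul_one_sub_posSemidef {n : Type*} [Fintype n] [DecidableEq n]
    {t : Matrix n n ℂ} (ht : t.IsHermitian) :
    ∃ c : ℝ, 0 < c ∧ ((c : ℂ) • (1 : Matrix n n ℂ) - t).PosSemidef := by
  open scoped MatrixOrder Matrix.Norms.L2Operator in
  obtain ⟨r, hr, h⟩ : ∃ r : ℝ, 0 ≤ r ∧ t ≤ algebraMap ℝ _ r :=
    ⟨‖t‖, norm_nonneg t, IsSelfAdjoint.le_algebraMap_norm_self (a := t) ht⟩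
  -- The extra `1` makes the bound strictly positive even for `t = 0`; it serves later as a
  -- denominator.
  refine ⟨r + 1, by positivity, ?_⟩
  have h1 : ((r + 1 : ℝ) : ℂ) • (1 : Matrix n n ℂ) - t =
      (algebraMap ℝ (Matrix n n ℂ) r - t) + 1 := by
    rw [Algebra.algebraMap_eq_smul_one, ← Complex.coe_smul]
    push_cast
    module
  rw [h1]
  open scoped MatrixOrder in
  exact (Matrix.le_iff.mp h).add PosSemidef.one

/-- Strong duality for the conditional min-entropy program, with both optima attained. -/
theorem exists_strong_duality [DecidableEq B] [Nonempty A] {C : Matrix (A × B) (A × B) ℂ}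
    (hC : C.PosSemidef) :
    ∃ (Y : Matrix (A × B) (A × B) ℂ) (ω : Matrix B B ℂ), Y.PosSemidef ∧ ptrace Y = 1 ∧
      ((1 : Matrix A A ℂ) ⊗ₖ ω - C).PosSemidef ∧ ω.trace = (C * Y).trace := by
  obtain ⟨Y, hY, hY1, hmax⟩ := exists_isMaxOn_trace_mul C
  have hd : (Fintype.card A : ℂ) ≠ 0 := Nat.cast_ne_zero.mpr Fintype.card_ne_zero
  -- The constraint may be relaxed to `tr_A Z ≤ 1`: padding with `1 ⊗ (1 - tr_A Z) / d` restores
  -- equality and cannot lower the value, because `C ≥ 0`.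
  have hmax' : ∀ Z : Matrix (A × B) (A × B) ℂ, Z.PosSemidef → (1 - ptrace Z).PosSemidef →
      (C * Z).trace.re ≤ (C * Y).trace.re := by
    intro Z hZ hZ1
    have hR : (((Fintype.card A : ℂ)⁻¹) • ((1 : Matrix A A ℂ) ⊗ₖ (1 - ptrace Z))).PosSemidef :=
      (posSemidef_one_kronecker hZ1).smul (by positivity)
    have h1 := hmax _ (hZ.add hR) (by
      rw [ptrace_add, ptrace_smul, ptrace_one_kronecker, smul_smul, inv_mul_cancel₀ hd, one_smul,
        add_sub_cancel])
    have h2 := (Complex.le_def.mp (trace_mul_nonneg hC hR)).1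
    rw [mul_add, Matrix.trace_add, Complex.add_re] at h1
    rw [Complex.zero_re] at h2
    linarith
  -- The Lagrange multiplier of the constraint: at an optimum one expects `(1 ⊗ ω) Y = C Y`, whence
  -- `ω = tr_A(C Y)`; it is symmetrised so as to be visibly Hermitian.
  let ω : Matrix B B ℂ := (2⁻¹ : ℂ) • (ptrace (C * Y) + ptrace (Y * C))
  have hωH : ω.IsHermitian := by
    have h1 : (ptrace (C * Y))ᴴ = ptrace (Y * C) := by
      rw [← ptrace_conjTranspose, conjTranspose_mul, hC.isHermitian, hY.isHermitian]
    have h2 : (ptrace (Y * C))ᴴ = ptrace (C * Y) := by rw [← h1, conjTranspose_conjTranspose]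
    simp only [IsHermitian, ω, conjTranspose_smul, conjTranspose_add, h1, h2]
    rw [add_comm]
    simp
  refine ⟨Y, ω, hY, hY1, ?_, ?_⟩
  · have hH : ((1 : Matrix A A ℂ) ⊗ₖ ω - C).IsHermitian := by
      refine IsHermitian.sub ?_ hC.isHermitian
      rw [IsHermitian, conjTranspose_kronecker, hωH, conjTranspose_one]
    refine PosSemidef.of_dotProduct_mulVec_nonneg hH fun v => ?_
    let V := vecMulVec v (star v)
    have hV : V.PosSemidef := posSemidef_vecMulVec_self_star v
    let t := ptrace V
    have ht : t.PosSemidef := posSemidef_ptrace hV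
    let T := (1 : Matrix A A ℂ) ⊗ₖ t
    obtain ⟨c, hc, hct⟩ := exists_smul_one_sub_posSemidef ht.isHermitian
    have hquad : ∀ M : Matrix (A × B) (A × B) ℂ, star v ⬝ᵥ (M *ᵥ v) = (M * V).trace := by
      intro M
      rw [Matrix.mul_vecMulVec, Matrix.trace_vecMulVec, dotProduct_comm]
    -- Perturb `Y` to `Y + ε V` and rescale on both sides by `1 ⊗ (1 - ε t / 2)`, which restores the
    -- partial trace to first order. The defect is `(ε²/4) t (3 - ε t) t`, nonnegative as long as `ε
    -- c ≤ 3`. The linear coefficient in `ε` is minus the expectation of `1 ⊗ ω - C` at `v`.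
    have hcub := nonpos_of_cubic_nonpos (δ := 3 / c)
      (a := (C * (V - (2⁻¹ : ℂ) • (T * Y + Y * T))).trace.re)
      (b := (C * ((4⁻¹ : ℂ) • (T * Y * T) - (2⁻¹ : ℂ) • (T * V + V * T))).trace.re)
      (c := (C * ((4⁻¹ : ℂ) • (T * V * T))).trace.re) (by positivity) (by
        intro ε hε hεc
        let S : Matrix B B ℂ := 1 - ((ε : ℂ) / 2) • t
        have hS : Sᴴ = S := by
          simp [S, ht.isHermitian.eq]
        have hKS : ((1 : Matrix A A ℂ) ⊗ₖ S) = 1 - ((ε : ℂ) / 2) • T := by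
          have : (1 : Matrix A A ℂ) ⊗ₖ S + ((ε : ℂ) / 2) • T = 1 := by
            rw [← kronecker_smul, ← kronecker_add, sub_add_cancel, one_kronecker_one]
          exact eq_sub_of_add_eq this
        have hKSH : ((1 : Matrix A A ℂ) ⊗ₖ S)ᴴ = (1 : Matrix A A ℂ) ⊗ₖ S := by
          rw [conjTranspose_kronecker, hS, conjTranspose_one]
        have hZ : (((1 : Matrix A A ℂ) ⊗ₖ S) * (Y + (ε : ℂ) • V) *
            ((1 : Matrix A A ℂ) ⊗ₖ S)).PosSemidef := by
          have hε0 : (0 : ℂ) ≤ ε := by exact_mod_cast hε.le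
          have := (hY.add (hV.smul hε0)).mul_mul_conjTranspose_same ((1 : Matrix A A ℂ) ⊗ₖ S)
          rwa [hKSH] at this
        have h1 := hmax' _ hZ (by
          rw [ptrace_mul_kronecker, ptrace_kronecker_mul, ptrace_add, ptrace_smul, hY1]
          have : 1 - S * (1 + (ε : ℂ) • ptrace V) * S =
              ((ε : ℂ) ^ 2 / 4) • (t * ((3 : ℂ) • (1 : Matrix B B ℂ) - (ε : ℂ) • t) * tᴴ) := by
            rw [ht.isHermitian.eq]
            simp only [S, show ptrace V = t from rfl]
            simp only [mul_add, add_mul, mul_sub, sub_mul, smul_mul_assoc, mul_smul_comm, mul_one,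
              one_mul, smul_sub, smul_add, smul_smul, mul_assoc]
            module
          rw [this]
          refine PosSemidef.smul (PosSemidef.mul_mul_conjTranspose_same ?_ t) ?_
          · have h3 : (3 : ℂ) • (1 : Matrix B B ℂ) - (ε : ℂ) • t =
                (ε : ℂ) • ((c : ℂ) • 1 - t) + ((3 - ε * c : ℝ) : ℂ) • 1 := by
              push_cast
              module
            rw [h3]
            refine (hct.smul (by exact_mod_cast hε.le)).add (PosSemidef.one.smul ?_)
            have := (le_div_iff₀ hc).mp hεc
            exact_mod_cast sub_nonneg.mpr this
          · have : (0 : ℝ) ≤ ε ^ 2 / 4 := by positivity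
            exact_mod_cast this)
        have hexp : ((1 : Matrix A A ℂ) ⊗ₖ S) * (Y + (ε : ℂ) • V) * ((1 : Matrix A A ℂ) ⊗ₖ S) =
            Y + ((ε : ℝ) : ℂ) • (V - (2⁻¹ : ℂ) • (T * Y + Y * T)) +
              ((ε ^ 2 : ℝ) : ℂ) • ((4⁻¹ : ℂ) • (T * Y * T) - (2⁻¹ : ℂ) • (T * V + V * T)) +
              ((ε ^ 3 : ℝ) : ℂ) • ((4⁻¹ : ℂ) • (T * V * T)) := by
          rw [hKS]
          simp only [mul_add, add_mul, mul_sub, sub_mul, smul_mul_assoc, mul_smul_comm, mul_one,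
            one_mul, mul_assoc]
          push_cast
          module
        rw [hexp, mul_add, mul_add, mul_add, Matrix.mul_smul C (ε : ℂ),
          Matrix.mul_smul C ((ε ^ 2 : ℝ) : ℂ), Matrix.mul_smul C ((ε ^ 3 : ℝ) : ℂ), Matrix.trace_add,
          Matrix.trace_add, Matrix.trace_add, Matrix.trace_smul, Matrix.trace_smul,
          Matrix.trace_smul, Complex.add_re, Complex.add_re, Complex.add_re, smul_eq_mul,
          smul_eq_mul, smul_eq_mul, Complex.re_ofReal_mul, Complex.re_ofReal_mul,
          Complex.re_ofReal_mul] at h1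
        linarith)
    have hlin : star v ⬝ᵥ (((1 : Matrix A A ℂ) ⊗ₖ ω - C) *ᵥ v) =
        -(C * (V - (2⁻¹ : ℂ) • (T * Y + Y * T))).trace := by
      rw [hquad, sub_mul, Matrix.trace_sub, ← trace_ptrace (_ * V), ptrace_kronecker_mul]
      have e1 : (C * (T * Y)).trace = (ptrace (Y * C) * t).trace := by
        rw [← mul_assoc, Matrix.trace_mul_comm, ← mul_assoc, ← trace_ptrace, ptrace_mul_kronecker]
      have e2 : (C * (Y * T)).trace = (ptrace (C * Y) * t).trace := by
        rw [← mul_assoc, ← trace_ptrace, ptrace_mul_kronecker]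
      rw [mul_sub, Matrix.mul_smul, mul_add, Matrix.trace_sub, Matrix.trace_smul, Matrix.trace_add,
        e1, e2]
      simp only [ω, smul_mul_assoc, add_mul, Matrix.trace_smul, Matrix.trace_add]
      change _ • ((ptrace (C * Y) * t).trace + (ptrace (Y * C) * t).trace) - _ = _
      simp only [smul_eq_mul]
      ring
    have him := hH.im_star_dotProduct_mulVec_self v
    refine Complex.le_def.mpr ⟨?_, ?_⟩
    · rw [hlin]
      simpa using hcub
    · exact him.symm
  · simp only [ω, Matrix.trace_smul, Matrix.trace_add, trace_ptrace]
    rw [Matrix.trace_mul_comm Y C, smul_eq_mul]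
    ring

end Duality

/-! ### Recovery and robustness as a dual pair of programs. -/

section Optimal

open scoped Kronecker

variable {A B X : Type*}

/-- The operator on `ℂ^A ⊗ ℂ^B` that represents a recovery map `Λ` in the trace pairing with
Choi matrices. -/
def recoveryOp [DecidableEq B] (Λ : Matrix B B ℂ →ₗ[ℂ] Matrix A A ℂ) :
    Matrix (A × B) (A × B) ℂ :=
  ((choi Λ).submatrix Prod.swap Prod.swap)ᵀ

theorem exists_recoveryOp_eq [Fintype B] [DecidableEq B] (Y : Matrix (A × B) (A × B) ℂ) :
    ∃ Λ : Matrix B B ℂ →ₗ[ℂ] Matrix A A ℂ, recoveryOp Λ = Y := by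
  refine ⟨ofChoi (Yᵀ.submatrix Prod.swap Prod.swap), ?_⟩
  ext x y
  simp [recoveryOp, choi_ofChoi]

/-- The map `ρ ↦ tr(ρ) ω`. -/
def traceSMul [Fintype A] (ω : Matrix B B ℂ) : Matrix A A ℂ →ₗ[ℂ] Matrix B B ℂ :=
  (Matrix.traceLinearMap A ℂ ℂ).smulRight ω

theorem traceSMul_apply [Fintype A] (ω : Matrix B B ℂ) (ρ : Matrix A A ℂ) :
    traceSMul ω ρ = ρ.trace • ω := rfl

theorem choi_traceSMul [Fintype A] [DecidableEq A] (ω : Matrix B B ℂ) :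
    choi (traceSMul (A := A) ω) = (1 : Matrix A A ℂ) ⊗ₖ ω := by
  ext ⟨i, b⟩ ⟨j, b'⟩
  by_cases h : i = j
  · subst h
    simp [choi, traceSMul_apply, Matrix.trace_single_eq_same]
  · simp [choi, traceSMul_apply, Matrix.trace_single_eq_of_ne _ _ _ h, Matrix.one_apply_ne h]

/-- Tracing out `A` in `1 ⊗ ω ≥ C ≥ 0` gives `d ω ≥ 0`, so dual feasibility already forces
positivity of `ω`. -/
theorem posSemidef_of_le_one_kronecker [Fintype A] [DecidableEq A] [Nonempty A]
    {C : Matrix (A × B) (A × B) ℂ} {ω : Matrix B B ℂ} (hC : C.PosSemidef)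
    (hω : ((1 : Matrix A A ℂ) ⊗ₖ ω - C).PosSemidef) : ω.PosSemidef := by
  have hd : (Fintype.card A : ℂ) ≠ 0 := Nat.cast_ne_zero.mpr Fintype.card_ne_zero
  have h := (posSemidef_ptrace (hω.add hC)).smul
    (show (0 : ℂ) ≤ (Fintype.card A : ℂ)⁻¹ by positivity)
  rwa [sub_add_cancel, ptrace_one_kronecker, smul_smul, inv_mul_cancel₀ hd, one_smul] at h

variable [Fintype A] [Fintype B]

theorem isChannel_iff_recoveryOp [DecidableEq B] (Λ : Matrix B B ℂ →ₗ[ℂ] Matrix A A ℂ) :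
    IsChannel Λ ↔ (recoveryOp Λ).PosSemidef ∧ ptrace (recoveryOp Λ) = 1 := by
  rw [IsChannel, isCompletelyPositive_iff_choi, isTracePreserving_iff_choi, recoveryOp,
    posSemidef_transpose_iff, ← posSemidef_submatrix_equiv (Equiv.prodComm A B)]
  refine and_congr Iff.rfl ?_
  rw [← Matrix.ext_iff]
  simp only [ptrace_apply, transpose_apply, submatrix_apply, Prod.swap_prod_mk]
  constructor
  · intro h b b'
    rw [h, Matrix.one_apply, Matrix.one_apply]
    simp only [eq_comm]
  · intro h b b'
    rw [h, Matrix.one_apply, Matrix.one_apply]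
    simp only [eq_comm]

theorem entPairing_comp_eq_trace [DecidableEq A] [DecidableEq B]
    (E : Matrix A A ℂ →ₗ[ℂ] Matrix B B ℂ) (Λ : Matrix B B ℂ →ₗ[ℂ] Matrix A A ℂ) :
    entPairing (Λ ∘ₗ E) = (choi E * recoveryOp Λ).trace := by
  rw [entPairing_comp]
  simp [Matrix.trace, Matrix.mul_apply, recoveryOp]

theorem entFidelity_eq [DecidableEq A] [DecidableEq B] [Fintype X]
    (E : X → Matrix A A ℂ →ₗ[ℂ] Matrix B B ℂ) (Λ : X → Matrix B B ℂ →ₗ[ℂ] Matrix A A ℂ) :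
    entFidelity E Λ =
      (∑ a, (choi (E a) * recoveryOp (Λ a)).trace.re) / (Fintype.card A : ℝ) ^ 2 := by
  simp only [entFidelity, expVal_maxEntVec, entPairing_comp_eq_trace, Finset.sum_div]

/-- The hidden variable can be absorbed: `τ_a = ∑_λ q_λ p(a|λ) σ_λ`. Conversely, let `λ` be the
outcome itself, with weight `tr τ_a`, deterministic response and state `τ_a / tr τ_a`. -/
theorem isNonInteractive_iff [Fintype X] (L : X → Matrix A A ℂ →ₗ[ℂ] Matrix B B ℂ) :
    IsNonInteractive L ↔ ∃ τ : X → Matrix B B ℂ, (∀ a, (τ a).PosSemidef) ∧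
      ∑ a, (τ a).trace = 1 ∧ ∀ a, L a = traceSMul (τ a) := by
  classical
  constructor
  · rintro ⟨m, q, p, σ, hq, hq1, hp, hp1, hσ, hL⟩
    refine ⟨fun a => ∑ l, ((q l * p a l : ℝ) : ℂ) • σ l, fun a => ?_, ?_, fun a => ?_⟩
    · exact posSemidef_sum _ fun l _ =>
        (hσ l).1.smul (by exact_mod_cast mul_nonneg (hq l) (hp a l))
    · simp only [Matrix.trace_sum, Matrix.trace_smul, (hσ _).2, smul_eq_mul, mul_one]
      rw [Finset.sum_comm]
      have : ∑ l, ∑ a, q l * p a l = 1 := by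
        simp only [← Finset.mul_sum, hp1, mul_one, hq1]
      exact_mod_cast this
    · ext1 ρ
      rw [hL, traceSMul_apply, Finset.smul_sum]
      exact Finset.sum_congr rfl fun l _ => by rw [smul_smul, mul_comm]
  · rintro ⟨τ, hτ, hτ1, hL⟩
    have hre : ∀ a, (τ a).trace = ((τ a).trace.re : ℂ) := fun a =>
      Complex.ext rfl (by simpa using (Complex.le_def.mp (hτ a).trace_nonneg).2.symm)
    have hnn : ∀ a, 0 ≤ (τ a).trace.re := fun a => (Complex.le_def.mp (hτ a).trace_nonneg).1
    have hstate : ∀ a, (τ a).trace ≠ 0 → IsState ((τ a).trace⁻¹ • τ a) := fun a ha =>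
      ⟨(hτ a).smul (inv_nonneg.mpr (hτ a).trace_nonneg), by
        rw [Matrix.trace_smul, smul_eq_mul, inv_mul_cancel₀ ha]⟩
    -- Outcomes of zero weight still need some state; the normalised `τ o` serves as a default.
    obtain ⟨o, ho⟩ : ∃ o, (τ o).trace ≠ 0 := by
      by_contra! h
      simp [h] at hτ1
    let e : Fin (Fintype.card X) ≃ X := (Fintype.equivFin X).symm
    refine ⟨Fintype.card X, fun l => (τ (e l)).trace.re, fun a l => if e l = a then 1 else 0,
      fun l => if (τ (e l)).trace = 0 then (τ o).trace⁻¹ • τ o else (τ (e l)).trace⁻¹ • τ (e l),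
      fun l => hnn _, ?_, fun a l => by dsimp only; split_ifs <;> norm_num, fun l => by simp,
      fun l => ?_, fun a ρ => ?_⟩
    · rw [e.sum_comp fun a => (τ a).trace.re, ← Complex.re_sum, hτ1, Complex.one_re]
    · dsimp only
      split_ifs with h
      · exact hstate o ho
      · exact hstate _ h
    · rw [hL, traceSMul_apply, Finset.sum_eq_single (e.symm a)]
      · simp only [Equiv.apply_symm_apply, if_true, mul_one, ← hre]
        split_ifs with h
        · rw [h, zero_mul, zero_smul, ((hτ a).trace_eq_zero_iff).mp h, smul_zero]
        · rw [smul_smul, mul_right_comm, mul_inv_cancel₀ h, one_mul]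
      · intro l _ hl
        have : e l ≠ a := fun h => hl (by rw [← h, Equiv.symm_apply_apply])
        simp [this]
      · simp

theorem sum_trace_choi [DecidableEq A] [Fintype X] {E : X → Matrix A A ℂ →ₗ[ℂ] Matrix B B ℂ}
    (hE : IsTracePreserving (∑ a, E a)) : ∑ a, (choi (E a)).trace = Fintype.card A := by
  rw [← Matrix.trace_sum, ← choi_sum]
  simp [Matrix.trace, Fintype.sum_prod_type, (isTracePreserving_iff_choi _).mp hE]

theorem trace_one_kronecker [DecidableEq A] (ω : Matrix B B ℂ) :
    ((1 : Matrix A A ℂ) ⊗ₖ ω).trace = Fintype.card A * ω.trace := by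
  rw [trace_kronecker, Matrix.trace_one]

/-- The noise is determined by `t N_a = tr(·) ω_a - E_a`, with `ω_a` equal to `1 + t` times the
non-interactive operator. Its complete positivity is the Choi inequality, and its trace
normalisation is the condition on `∑_a tr ω_a`. -/
theorem mem_robustnessFeasible_iff [DecidableEq A] [Nonempty A] [Fintype X]
    {E : X → Matrix A A ℂ →ₗ[ℂ] Matrix B B ℂ} (hE : IsInstrument E) (t : ℝ) :
    t ∈ robustnessFeasible E ↔ 0 ≤ t ∧ ∃ ω : X → Matrix B B ℂ,
      (∀ a, ((1 : Matrix A A ℂ) ⊗ₖ ω a - choi (E a)).PosSemidef) ∧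
        ∑ a, (ω a).trace = ((1 + t : ℝ) : ℂ) := by
  have hC : ∀ a, (choi (E a)).PosSemidef := fun a =>
    (isCompletelyPositive_iff_choi _).mp (hE.1 a)
  refine and_congr_right fun ht => ?_
  constructor
  · rintro ⟨N, hN, hNI⟩
    obtain ⟨τ, hτ, hτ1, hL⟩ := (isNonInteractive_iff _).mp hNI
    refine ⟨fun a => ((1 + t : ℝ) : ℂ) • τ a, fun a => ?_, ?_⟩
    · have h1 : E a + (t : ℂ) • N a = ((1 + t : ℝ) : ℂ) • traceSMul (τ a) := by
        rw [← hL a, smul_smul, ← Complex.ofReal_mul, mul_inv_cancel₀ (by positivity),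
          Complex.ofReal_one, one_smul]
      have h2 : (1 : Matrix A A ℂ) ⊗ₖ (((1 + t : ℝ) : ℂ) • τ a) - choi (E a) =
          (t : ℂ) • choi (N a) := by
        rw [kronecker_smul, ← choi_traceSMul]
        have h3 : ((1 + t : ℝ) : ℂ) • choi (traceSMul (A := A) (τ a)) =
            choi (E a + (t : ℂ) • N a) := by rw [h1]; rfl
        rw [h3]
        exact add_sub_cancel_left (choi (E a)) _
      rw [h2]
      exact ((isCompletelyPositive_iff_choi _).mp (hN.1 a)).smul (by exact_mod_cast ht)
    · simp only [Matrix.trace_smul, smul_eq_mul, ← Finset.mul_sum, hτ1, mul_one]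
  · rintro ⟨ω, hω, hω1⟩
    have hdiff : ∑ a, ((1 : Matrix A A ℂ) ⊗ₖ ω a - choi (E a)).trace = Fintype.card A * t := by
      simp only [Matrix.trace_sub, Finset.sum_sub_distrib, trace_one_kronecker, ← Finset.mul_sum,
        hω1, sum_trace_choi hE.2.2.2]
      push_cast
      ring
    obtain ⟨N, hN, hEN⟩ : ∃ N : X → Matrix A A ℂ →ₗ[ℂ] Matrix B B ℂ, IsInstrument N ∧
        ∀ a, E a + (t : ℂ) • N a = traceSMul (ω a) := by
      rcases ht.eq_or_lt with rfl | hpos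
      -- At `t = 0` the positive differences have total trace zero, so they vanish and `E` is itself
      -- non-interactive. The noise is then irrelevant, and `E` is a convenient instrument to
      -- supply.
      · refine ⟨E, hE, fun a => ?_⟩
        rw [Complex.ofReal_zero, mul_zero,
          Finset.sum_eq_zero_iff_of_nonneg fun a _ => (hω a).trace_nonneg] at hdiff
        have h0 := ((hω a).trace_eq_zero_iff).mp (hdiff a (Finset.mem_univ a))
        rw [Complex.ofReal_zero, zero_smul, add_zero]
        apply choi_injective
        rw [choi_traceSMul]
        exact (sub_eq_zero.mp h0).symm
      · have htc : (t : ℂ) ≠ 0 := by exact_mod_cast hpos.ne'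
        refine ⟨fun a => (t : ℂ)⁻¹ • (traceSMul (ω a) - E a),
          isInstrument_of_isCompletelyPositive (fun a => ?_) fun ρ => ?_, fun a => ?_⟩
        · rw [isCompletelyPositive_iff_choi]
          have : choi ((t : ℂ)⁻¹ • (traceSMul (ω a) - E a)) =
              (t : ℂ)⁻¹ • ((1 : Matrix A A ℂ) ⊗ₖ ω a - choi (E a)) := by
            rw [← choi_traceSMul]
            rfl
          rw [this]
          exact (hω a).smul (inv_nonneg.mpr (by exact_mod_cast ht))
        · have hEρ : ∑ a, (E a ρ).trace = ρ.trace := by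
            rw [← Matrix.trace_sum, ← LinearMap.sum_apply, hE.2.2.2 ρ]
          simp only [LinearMap.sum_apply, LinearMap.smul_apply, LinearMap.sub_apply,
            traceSMul_apply, Matrix.trace_sum, Matrix.trace_smul, Matrix.trace_sub, smul_eq_mul,
            ← Finset.mul_sum, Finset.sum_sub_distrib, hω1, hEρ]
          rw [inv_mul_eq_iff_eq_mul₀ htc]
          push_cast
          ring
        · rw [smul_smul, mul_inv_cancel₀ htc, one_smul, add_sub_cancel]
    refine ⟨N, hN, (isNonInteractive_iff _).mpr ⟨fun a => (((1 + t)⁻¹ : ℝ) : ℂ) • ω a,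
      fun a => ?_, ?_, fun a => ?_⟩⟩
    · exact (posSemidef_of_le_one_kronecker (hC a) (hω a)).smul
        (by exact_mod_cast (by positivity : (0 : ℝ) ≤ (1 + t)⁻¹))
    · simp only [Matrix.trace_smul, smul_eq_mul, ← Finset.mul_sum, hω1, ← Complex.ofReal_mul]
      rw [inv_mul_cancel₀ (by positivity), Complex.ofReal_one]
    · rw [hEN]
      ext1 ρ
      rw [LinearMap.smul_apply, traceSMul_apply, traceSMul_apply, smul_comm]

/-- The optima of the robustness and of the recovery problems, in terms of a common value. -/
theorem exists_optimal_value [DecidableEq A] [Nonempty A] [Fintype X]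
    {E : X → Matrix A A ℂ →ₗ[ℂ] Matrix B B ℂ} (hE : IsInstrument E) :
    ∃ γ : ℝ, IsLeast (robustnessFeasible E) (γ - 1) ∧
      IsGreatest (entFidelityValues E) (γ / (Fintype.card A : ℝ) ^ 2) := by
  classical
  have hC : ∀ a, (choi (E a)).PosSemidef := fun a =>
    (isCompletelyPositive_iff_choi _).mp (hE.1 a)
  choose Y ω hY hY1 hω hωY using fun a => exists_strong_duality (hC a)
  have hre : ∀ a, (ω a).trace = ((ω a).trace.re : ℂ) := fun a =>
    Complex.ext rfl (by simpa using
      (Complex.le_def.mp (posSemidef_of_le_one_kronecker (hC a) (hω a)).trace_nonneg).2.symm)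
  have hd : (0 : ℝ) < Fintype.card A := Nat.cast_pos.mpr Fintype.card_pos
  refine ⟨∑ a, (ω a).trace.re, ⟨(mem_robustnessFeasible_iff hE _).mpr ⟨?_, ω, hω, ?_⟩, ?_⟩,
    ?_, ?_⟩
  -- Feasibility requires `γ ≥ 1`: take traces in `1 ⊗ ω_a ≥ C_a` and sum, using `∑_a tr C_a = d`.
  · have h := Finset.sum_nonneg fun a (_ : a ∈ Finset.univ) => (hω a).trace_nonneg
    simp only [Matrix.trace_sub, Finset.sum_sub_distrib, trace_one_kronecker, ← Finset.mul_sum,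
      sum_trace_choi hE.2.2.2] at h
    have h1 := (Complex.le_def.mp h).1
    rw [Complex.zero_re, Complex.sub_re, Complex.natCast_re, ← Complex.ofReal_natCast,
      Complex.re_ofReal_mul, Complex.re_sum] at h1
    have h2 : (Fintype.card A : ℝ) * 1 ≤ Fintype.card A * ∑ a, (ω a).trace.re := by linarith
    exact sub_nonneg.mpr (le_of_mul_le_mul_left h2 hd)
  · rw [add_sub_cancel, Complex.ofReal_sum]
    exact Finset.sum_congr rfl fun a _ => hre a
  · intro t ht
    obtain ⟨-, ω', hω', hω'1⟩ := (mem_robustnessFeasible_iff hE t).mp ht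
    have h1 : ∑ a, (ω' a).trace.re = 1 + t := by
      rw [← Complex.re_sum, hω'1, Complex.ofReal_re]
    rw [sub_le_iff_le_add', ← h1]
    refine Finset.sum_le_sum fun a _ => ?_
    rw [hωY]
    exact (Complex.le_def.mp (trace_mul_le_of_le_one_kronecker (hY a) (hY1 a) (hω' a))).1
  · choose Λ hΛ using fun a => exists_recoveryOp_eq (Y a)
    refine ⟨Λ, fun a => ?_, ?_⟩
    · rw [isChannel_iff_recoveryOp, hΛ]
      exact ⟨hY a, hY1 a⟩
    · rw [entFidelity_eq]
      simp only [hΛ, hωY]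
  · rintro _ ⟨Λ, hΛ, rfl⟩
    rw [entFidelity_eq]
    gcongr with a
    obtain ⟨h1, h2⟩ := (isChannel_iff_recoveryOp _).mp (hΛ a)
    exact trace_mul_le_of_le_one_kronecker h1 h2 (hω a)

end Optimal
end QInstrument

theorem mainTheorem4 {A B X : Type*} [Fintype A] [DecidableEq A] [Nonempty A]
    [Fintype B] [Fintype X]
    (E : X → Matrix A A ℂ →ₗ[ℂ] Matrix B B ℂ) (hE : QInstrument.IsInstrument E) :
    IsLeast (QInstrument.robustnessFeasible E) (QInstrument.robustness E) ∧
    IsGreatest (QInstrument.avgFidelityValues E) (QInstrument.Fave E) ∧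
    IsGreatest (QInstrument.entFidelityValues E) (QInstrument.Fplus E) ∧
    QInstrument.Fave E =
      1 / (Fintype.card A : ℝ) * (1 + QInstrument.robustness E / ((Fintype.card A : ℝ) + 1)) ∧
    QInstrument.Fave E =
      (1 + (Fintype.card A : ℝ) * QInstrument.Fplus E) / ((Fintype.card A : ℝ) + 1) := by
  obtain ⟨γ, hR, hF⟩ := QInstrument.exists_optimal_value hE
  -- For fixed `E` the average fidelity is an increasing affine function of the entanglement
  -- fidelity, so the same recovery is optimal for both.
  have hA : IsGreatest (QInstrument.avgFidelityValues E)
      ((1 + Fintype.card A * (γ / (Fintype.card A : ℝ) ^ 2)) / (Fintype.card A + 1)) := by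
    obtain ⟨⟨Λ, hΛ, hγ⟩, hmax⟩ := hF
    refine ⟨⟨Λ, hΛ, ?_⟩, ?_⟩
    · rw [QInstrument.avgFidelity_eq hE.2.2.2 fun a => (hΛ a).2, hγ]
    · rintro _ ⟨Λ', hΛ', rfl⟩
      rw [QInstrument.avgFidelity_eq hE.2.2.2 fun a => (hΛ' a).2]
      have := hmax ⟨Λ', hΛ', rfl⟩
      gcongr
  have eR : QInstrument.robustness E = γ - 1 := hR.csInf_eq
  have eF : QInstrument.Fplus E = γ / (Fintype.card A : ℝ) ^ 2 := hF.csSup_eq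
  have eA : QInstrument.Fave E = _ := hA.csSup_eq
  have hd : (Fintype.card A : ℝ) ≠ 0 := Nat.cast_ne_zero.mpr Fintype.card_ne_zero
  have hd1 : (Fintype.card A : ℝ) + 1 ≠ 0 := Nat.cast_add_one_ne_zero _
  rw [eR, eF, eA]
  refine ⟨hR, hA, hF, ?_, rfl⟩
  field_simp
  ring
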